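/- Let $k\ge 12$ be an integer, put $D=\frac{2^k}{4ek}$, and let $\alpha>0$ be a real constant with $\alpha k\le D/3$. Put $\gamma=\bigl(e\,(e^2\alpha)^{1/(k-2)}\bigr)^{-1}$. For a positive integer $n$ let $m=\lfloor\alpha n\rfloor$, and let $G\sim G_k(n,m)$ be the random $k$-uniform hypergraph on $[n]$ whose $m$ edges are chosen independently and uniformly, with replacement, from the $\binom nk$ subsets of $[n]$ of size $k$; repeated edges are counted with multiplicity, and $\deg(v)$ is the number of edges containing $v$. (Here $n\ge k$; only the limit $n\to\infty$ matters.) Construct vertex sets $V_0,V_1,\dots\subseteq[n]$ and sets of edges $E_0,E_1,\dots$ of $G$ as follows. Let $V_0=\{v:\deg(v)>D\}$ and $E_0=\emptyset$. For $i\ge1$ let $E_i$ be the set of all edges not in $E_0\cup\dots\cup E_{i-1}$ that have at least two vertices in $V_0\cup\dots\cup V_{i-1}$, and let $V_i$ be the set of all vertices of edges in $E_i$ that are not in $V_0\cup\dots\cup V_{i-1}$. Stop at the first step $s\ge1$ with $E_s=\emptyset$, and let $V_{\mathcal H}=V_0\cup\dots\cup V_s$. Then there are a constant $\epsilon_0<\gamma$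 (which may depend on $k$ and $\alpha$ but not on $n$) and a sequence $\delta_n\to0$ such that $$\Pr\bigl[\,|V_{\mathcal H}|\le(\epsilon_0+\delta_n)\,n\,\bigr]\longrightarrow 1\qquad(n\to\infty).$$ -/

import Mathlib

open Filter Topology

/-- A `k`-uniform hypergraph on the vertex set `Fin n` with `m` labelled edges. Edges may be
repeated, and are then counted with multiplicity. -/
abbrev UniformHypergraph (k n m : ℕ) : Type :=
  Fin m → {s : Finset (Fin n) // s.card = k}

/-- The probability of the event `P` for a hypergraph drawn from `G_k(n,m)`: the `m` edges are
chosen independently and uniformly, with replacement, among the `n.choose k` vertex sets of size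
`k`. Thus all `(n.choose k) ^ m` sequences of edges are equally likely. -/
noncomputable def gnmProb (k n m : ℕ) (P : UniformHypergraph k n m → Prop) : ℝ :=
  (Nat.card {G : UniformHypergraph k n m // P G} : ℝ) / (Nat.card (UniformHypergraph k n m) : ℝ)

namespace HighDegree

variable {k n m : ℕ}

/-- The degree of a vertex: the number of edges, with multiplicity, that contain it. -/
def degree (G : UniformHypergraph k n m) (v : Fin n) : ℕ :=
  (Finset.univ.filter fun e : Fin m => v ∈ (G e).1).card

/-- One step of the construction: the vertex set `V_i` and edge set `E_i` added in that step,
and everything collected so far, `V_0 ∪ ⋯ ∪ V_i` and `E_0 ∪ ⋯ ∪ E_i`. -/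
structure Stage (n m : ℕ) where
  newV : Finset (Fin n)
  newE : Finset (Fin m)
  allV : Finset (Fin n)
  allE : Finset (Fin m)

/-- The edges not collected yet that have at least two vertices among those collected. -/
def nextEdges (G : UniformHypergraph k n m) (S : Stage n m) : Finset (Fin m) :=
  Finset.univ.filter fun e => e ∉ S.allE ∧ 2 ≤ ((G e).1 ∩ S.allV).card

/-- The vertices of those edges that are not collected yet. -/
def nextVertices (G : UniformHypergraph k n m) (S : Stage n m) : Finset (Fin n) :=
  ((nextEdges G S).biUnion fun e => (G e).1) \ S.allV

/-- The `i`-th step of the construction with cut-off degree `D`. -/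
noncomputable def stage (G : UniformHypergraph k n m) (D : ℝ) : ℕ → Stage n m
  | 0 =>
    { newV := Finset.univ.filter fun v => D < (degree G v : ℝ)
      newE := ∅
      allV := Finset.univ.filter fun v => D < (degree G v : ℝ)
      allE := ∅ }
  | i + 1 =>
    { newV := nextVertices G (stage G D i)
      newE := nextEdges G (stage G D i)
      allV := (stage G D i).allV ∪ nextVertices G (stage G D i)
      allE := (stage G D i).allE ∪ nextEdges G (stage G D i) }

/-- The construction stops. -/
theorem exists_stop (G : UniformHypergraph k n m) (D : ℝ) :
    ∃ s : ℕ, 1 ≤ s ∧ (stage G D s).newE = ∅ := by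
  by_contra! h
  have key : ∀ i : ℕ, i ≤ (stage G D i).allE.card := by
    intro i
    induction i with
    | zero => exact Nat.zero_le _
    | succ i ih =>
      have hne : (nextEdges G (stage G D i)).Nonempty := h (i + 1) (by omega)
      have hd : Disjoint (stage G D i).allE (nextEdges G (stage G D i)) := by
        rw [Finset.disjoint_left]
        intro e he he'
        exact (Finset.mem_filter.mp he').2.1 he
      have hc : (stage G D (i + 1)).allE.card
          = (stage G D i).allE.card + (nextEdges G (stage G D i)).card :=
        Finset.card_union_of_disjoint hd
      have := hne.card_pos
      omega
  have h1 := key (m + 1)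
  have h2 := Finset.card_le_univ (stage G D (m + 1)).allE
  rw [Fintype.card_fin] at h2
  omega

/-- The first step `s ≥ 1` with `E_s = ∅`. -/
noncomputable def stopStep (G : UniformHypergraph k n m) (D : ℝ) : ℕ :=
  Nat.find (exists_stop G D)

/-- The high-degree part `V_H = V_0 ∪ ⋯ ∪ V_s`. -/
noncomputable def highPart (G : UniformHypergraph k n m) (D : ℝ) : Finset (Fin n) :=
  (Finset.range (stopStep G D + 1)).biUnion fun i => (stage G D i).newV

end HighDegree

/-- The cut-off degree `D = 2^k / (4 e k)`. -/
noncomputable def cutoffDegree (k : ℕ) : ℝ :=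
  2 ^ k / (4 * Real.exp 1 * k)

/-- The constant `γ = (e (e² α)^{1/(k-2)})⁻¹`. -/
noncomputable def matchingGamma (k : ℕ) (α : ℝ) : ℝ :=
  (Real.exp 1 * (Real.exp 1 ^ 2 * α) ^ (1 / ((k : ℝ) - 2)))⁻¹

/-! The bound is proved with `ε₀ = θ = 1/(4Dk²)` and `δ = 0`. Average degrees are at most `αk ≤
D/3`, so having degree above `D` is a large deviation: a set `U` of such vertices satisfies
`3^(-D|U|) ∏ 3^|e ∩ U| ≥ 1`, and summing the expectation of this weight over all `U` shows that
`V_0` has at most `θn/8` vertices with high probability.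

From a set of `θn` vertices the closure process is subcritical: about `αn(kθ)²/2 ≤ θn/(24k)` edges
have two vertices inside a fixed such set, far fewer than the order of `θn/k` edges needed to reach
that size. The set is however determined by the edges. So vertices are listed as they are found, and
round `j` opens the unopened edges through entry `j` and some earlier entry `i`. Recording `(i, j)`
for every opened edge gives a code `δ` (`exists_trace`): either the list closes up within `T = ⌊θn⌋`
entries, or more than `(T - |U|)/k` edges are opened.

The second case is excluded by a union bound over `U` and `δ`. With the code fixed, the two vertices
required of an edge depend only on edges of earlier rounds, so the edges can be counted one at a
time (`sum_prod_adaptive_le`). The tilt `3^|e ∩ U|` is kept throughout, which handles the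
conditioning on high degrees together with the exploration. A weight `e²` per opened edge supplies
the exponential decay (`gnmProb_card_highPart_gt_le`). -/

/-! ### Counting `k`-sets and a tilted count of intersections -/

/-- The number of `k`-sets above `B` is at most `(k / n) ^ |B|` times the number of all `k`-sets. -/
theorem choose_sub_le_pow_mul_choose {n k : ℕ} (hn : 0 < n) (hkn : k ≤ n) :
    ∀ b : ℕ, b ≤ k → ((n - b).choose (k - b) : ℝ) ≤ ((k : ℝ) / n) ^ b * n.choose k := by
  intro b
  induction b with
  | zero => simp
  | succ b ih =>
    intro hb
    have h1 := ih (by omega)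
    obtain ⟨n', hn'⟩ : ∃ n', n - b = n' + 1 := ⟨n - b - 1, by omega⟩
    obtain ⟨k', hk'⟩ : ∃ k', k - b = k' + 1 := ⟨k - b - 1, by omega⟩
    have h2 : n - (b + 1) = n' := by omega
    have h3 : k - (b + 1) = k' := by omega
    rw [hn', hk'] at h1
    rw [h2, h3]
    have h4 : ((n' : ℝ) + 1) * (n'.choose k' : ℝ) = ((n' + 1).choose (k' + 1) : ℝ) * (k' + 1) := by
      exact_mod_cast Nat.add_one_mul_choose_eq n' k'
    have h5 : (n' + 1 : ℝ) = n - b := by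
      have : n = n' + 1 + b := by omega
      rw [this]; push_cast; ring
    have h6 : (k' + 1 : ℝ) = k - b := by
      have : k = k' + 1 + b := by omega
      rw [this]; push_cast; ring
    have hn0 : (0 : ℝ) < n := by exact_mod_cast hn
    have hpos : (0 : ℝ) < n' + 1 := by positivity
    have hratio : (k' + 1 : ℝ) / (n' + 1) ≤ (k : ℝ) / n := by
      rw [div_le_div_iff₀ hpos hn0, h5, h6]
      have : (k : ℝ) ≤ n := by exact_mod_cast hkn
      have : (0 : ℝ) ≤ b := by positivity
      nlinarith
    calc (n'.choose k' : ℝ) = (k' + 1 : ℝ) / (n' + 1) * ((n' + 1).choose (k' + 1) : ℝ) := by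
          field_simp; linarith
      _ ≤ (k : ℝ) / n * (((k : ℝ) / n) ^ b * n.choose k) := by gcongr
      _ = _ := by ring

theorem card_filter_superset_le {n k : ℕ} (hn : 0 < n) (hkn : k ≤ n) (B : Finset (Fin n)) :
    ((Finset.univ.filter fun s : {s : Finset (Fin n) // s.card = k} => B ⊆ s.1).card : ℝ)
      ≤ ((k : ℝ) / n) ^ B.card * n.choose k := by
  by_cases hb : B.card ≤ k
  · refine le_trans ?_ (choose_sub_le_pow_mul_choose hn hkn B.card hb)
    have hc : (Finset.powersetCard (k - B.card) Bᶜ).card = (n - B.card).choose (k - B.card) := by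
      rw [Finset.card_powersetCard, Finset.card_compl, Fintype.card_fin]
    rw [← hc]
    norm_cast
    refine Finset.card_le_card_of_injOn (fun s => s.1 \ B) ?_ ?_
    · intro s hs
      have hs' : B ⊆ s.1 := by simpa using hs
      rw [Finset.mem_coe, Finset.mem_powersetCard]
      refine ⟨fun x hx => ?_, ?_⟩
      · simp only [Finset.mem_sdiff, Finset.mem_compl] at hx ⊢
        exact hx.2
      · rw [Finset.card_sdiff_of_subset hs', s.2]
    · intro s hs t ht hst
      have hs' : B ⊆ s.1 := by simpa using hs
      have ht' : B ⊆ t.1 := by simpa using ht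
      apply Subtype.ext
      rw [← Finset.sdiff_union_of_subset hs', ← Finset.sdiff_union_of_subset ht']
      exact congrArg (· ∪ B) hst
  · have : (Finset.univ.filter fun s : {s : Finset (Fin n) // s.card = k} => B ⊆ s.1) = ∅ := by
      rw [Finset.filter_eq_empty_iff]
      intro s _ hs
      have := Finset.card_le_card hs
      rw [s.2] at this
      exact hb this
    rw [this]
    simp only [Finset.card_empty, Nat.cast_zero]
    positivity

theorem three_pow_card_eq_sum {α : Type*} [DecidableEq α] (A : Finset α) :
    (3 : ℝ) ^ A.card = ∑ B ∈ A.powerset, 2 ^ B.card := by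
  have := Finset.prod_add (fun _ : α => (2 : ℝ)) (fun _ => 1) A
  simp only [Finset.prod_const, mul_one, one_pow] at this
  rw [← this]
  norm_num

/-- An exponential moment of `|s ∩ U|` for a random `k`-set `s` that contains `Z`. -/
theorem sum_three_pow_inter_le {n k : ℕ} (hn : 0 < n) (hkn : k ≤ n) (U Z : Finset (Fin n)) :
    ∑ s : {s : Finset (Fin n) // s.card = k} with Z ⊆ s.1, (3 : ℝ) ^ (s.1 ∩ U).card
      ≤ n.choose k * (((k : ℝ) / n) ^ Z.card * 3 ^ (Z ∩ U).card * (1 + 2 * ((k : ℝ) / n)) ^ U.card) := by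
  set p : ℝ := (k : ℝ) / n with hp
  have hp0 : 0 ≤ p := by positivity
  have h1 : ∀ s : {s : Finset (Fin n) // s.card = k}, (3 : ℝ) ^ (s.1 ∩ U).card
      = ∑ B ∈ U.powerset, if B ⊆ s.1 then (2 : ℝ) ^ B.card else 0 := by
    intro s
    rw [three_pow_card_eq_sum, ← Finset.sum_filter]
    apply Finset.sum_congr _ (fun _ _ => rfl)
    ext B
    simp only [Finset.mem_powerset, Finset.mem_filter, Finset.subset_inter_iff]
    tauto
  have h2 : ∑ s : {s : Finset (Fin n) // s.card = k} with Z ⊆ s.1, (3 : ℝ) ^ (s.1 ∩ U).card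
      = ∑ B ∈ U.powerset, (2 : ℝ) ^ B.card *
        ((Finset.univ.filter fun s : {s : Finset (Fin n) // s.card = k} => B ∪ Z ⊆ s.1).card : ℝ) := by
    simp_rw [h1]
    rw [Finset.sum_comm]
    apply Finset.sum_congr rfl
    intro B _
    rw [← Finset.sum_filter, Finset.filter_filter, Finset.sum_const, nsmul_eq_mul, mul_comm]
    congr 3
    ext s
    simp only [Finset.mem_filter, Finset.union_subset_iff]
    tauto
  -- A vertex of `B` already in `Z` costs no further factor `p`, so the sum over `B` factorises over
  -- the vertices of `U`.
  have h3 : ∑ B ∈ U.powerset, (2 : ℝ) ^ B.card * p ^ (B ∪ Z).card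
      = p ^ Z.card * ∏ v ∈ U, (2 * (if v ∈ Z then 1 else p) + 1) := by
    rw [Finset.prod_add, Finset.mul_sum]
    apply Finset.sum_congr rfl
    intro B _
    rw [Finset.prod_const_one, mul_one, Finset.prod_mul_distrib, Finset.prod_const,
      Finset.prod_ite, Finset.prod_const_one, one_mul, Finset.prod_const]
    have : (B ∪ Z).card = Z.card + (B.filter fun v => v ∉ Z).card := by
      rw [← Finset.sdiff_eq_filter, ← Finset.card_union_of_disjoint Finset.disjoint_sdiff,
        Finset.union_sdiff_self_eq_union, Finset.union_comm]
    rw [this, pow_add]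
    ring
  have h4 : ∏ v ∈ U, (2 * (if v ∈ Z then 1 else p) + 1)
      ≤ 3 ^ (Z ∩ U).card * (1 + 2 * p) ^ U.card := by
    have e1 : (3 : ℝ) ^ (Z ∩ U).card = ∏ v ∈ U, if v ∈ Z then (3 : ℝ) else 1 := by
      rw [Finset.prod_ite, Finset.prod_const_one, mul_one, Finset.prod_const,
        Finset.filter_mem_eq_inter, Finset.inter_comm]
    have e2 : (1 + 2 * p) ^ U.card = ∏ v ∈ U, (1 + 2 * p) := by rw [Finset.prod_const]
    rw [e1, e2, ← Finset.prod_mul_distrib]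
    apply Finset.prod_le_prod
    · intro v _; split_ifs <;> positivity
    · intro v _; split_ifs <;> nlinarith
  rw [h2]
  calc _ ≤ ∑ B ∈ U.powerset, (2 : ℝ) ^ B.card * (p ^ (B ∪ Z).card * n.choose k) := by
        gcongr with B _
        exact card_filter_superset_le hn hkn _
    _ = n.choose k * ∑ B ∈ U.powerset, (2 : ℝ) ^ B.card * p ^ (B ∪ Z).card := by
        rw [Finset.mul_sum]
        exact Finset.sum_congr rfl fun _ _ => by ring
    _ = n.choose k * (p ^ Z.card * ∏ v ∈ U, (2 * (if v ∈ Z then 1 else p) + 1)) := by rw [h3]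
    _ ≤ n.choose k * (p ^ Z.card * (3 ^ (Z ∩ U).card * (1 + 2 * p) ^ U.card)) := by gcongr
    _ = _ := by ring

/-! ### Counting with adaptively revealed constraints -/

/-- Averaging over one coordinate. -/
theorem sum_sum_update {E Ω : Type*} [Fintype E] [DecidableEq E] [Fintype Ω] (e : E)
    (h : (E → Ω) → ℝ) :
    ∑ G : E → Ω, ∑ s : Ω, h (Function.update G e s) = Fintype.card Ω * ∑ G, h G := by
  -- Exchanging the value at `e` with the spare value `s` permutes the pairs `(G, s)`.
  have hinv : Function.Involutive
      (fun x : (E → Ω) × Ω => (Function.update x.1 e x.2, x.1 e)) := by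
    intro x
    simp
  rw [← Fintype.sum_prod_type' (fun (G : E → Ω) (s : Ω) => h (Function.update G e s))]
  refine (Equiv.sum_comp hinv.toPerm (fun x : (E → Ω) × Ω => h x.1)).trans ?_
  rw [Fintype.sum_prod_type]
  simp [Finset.mul_sum]

/-- Counting configurations under constraints that are revealed one coordinate after the other:
the constraint on coordinate `e` only depends on the coordinates of smaller rank. -/
theorem sum_prod_adaptive_le {E Ω : Type*} [Fintype E] [DecidableEq E] [Fintype Ω]
    (ρ : E → ℕ) (w : Ω → ℝ) (hw : ∀ s, 0 ≤ w s) (C : (E → Ω) → E → Ω → Prop)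
    (hC : ∀ G G' e, (∀ e', ρ e' < ρ e → G e' = G' e') → C G e = C G' e)
    (c : E → ℝ) (hc0 : ∀ e, 0 ≤ c e)
    [∀ G e, DecidablePred (C G e)]
    (hc : ∀ G e, ∑ s with C G e s, w s ≤ c e) (S : Finset E) :
    (Fintype.card Ω : ℝ) ^ S.card *
      ∑ G : E → Ω, ∏ e ∈ S, (if C G e (G e) then w (G e) else 0)
      ≤ (Fintype.card Ω : ℝ) ^ Fintype.card E * ∏ e ∈ S, c e := by
  induction S using Finset.induction_on_max_value ρ with
  | empty => simp
  | insert e S he hmax ih =>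
    -- The coordinate `e` of largest rank is revealed last. Ties do no harm, since constraints look
    -- only at strictly smaller ranks.
    have hupd : ∀ (G : E → Ω) (s : Ω) (e'), ρ e' ≤ ρ e → C (Function.update G e s) e' = C G e' := by
      intro G s e' h
      apply hC
      intro e'' h''
      rw [Function.update_of_ne]
      rintro rfl
      omega
    have hstep : (Fintype.card Ω : ℝ) *
        ∑ G : E → Ω, ∏ e ∈ insert e S, (if C G e (G e) then w (G e) else 0)
        ≤ c e * ∑ G : E → Ω, ∏ e ∈ S, (if C G e (G e) then w (G e) else 0) := by
      rw [← sum_sum_update e, Finset.mul_sum]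
      apply Finset.sum_le_sum
      intro G _
      have : ∀ s : Ω, ∏ e' ∈ insert e S,
          (if C (Function.update G e s) e' (Function.update G e s e')
            then w (Function.update G e s e') else 0)
          = (if C G e s then w s else 0) * ∏ e ∈ S, (if C G e (G e) then w (G e) else 0) := by
        intro s
        rw [Finset.prod_insert he]
        congr 1
        · simp [hupd G s e le_rfl]
        · apply Finset.prod_congr rfl
          intro e' he'
          have hne : e' ≠ e := fun h => he (h ▸ he')
          simp [hupd G s e' (hmax e' he'), Function.update_of_ne hne]
      simp_rw [this]
      rw [← Finset.sum_mul, ← Finset.sum_filter]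
      refine mul_le_mul_of_nonneg_right (hc G e) (Finset.prod_nonneg fun e' _ => ?_)
      split_ifs
      · exact hw _
      · exact le_rfl
    rw [Finset.card_insert_of_notMem he, Finset.prod_insert he, pow_succ, mul_assoc]
    calc _ ≤ (Fintype.card Ω : ℝ) ^ S.card *
          (c e * ∑ G : E → Ω, ∏ e ∈ S, (if C G e (G e) then w (G e) else 0)) := by gcongr
      _ = c e * ((Fintype.card Ω : ℝ) ^ S.card *
          ∑ G : E → Ω, ∏ e ∈ S, (if C G e (G e) then w (G e) else 0)) := by ring
      _ ≤ c e * ((Fintype.card Ω : ℝ) ^ Fintype.card E * ∏ e ∈ S, c e) :=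
          mul_le_mul_of_nonneg_left ih (hc0 e)
      _ = _ := by ring

/-! ### Exploration from a vertex set and its code -/

namespace HighDegree

variable {k n m : ℕ}

/-- A vertex set that contains the high-degree vertices, and all vertices of each edge that meets
it in at least two vertices, contains the high-degree part. -/
theorem highPart_subset_of_closed (G : UniformHypergraph k n m) (D : ℝ) (W : Finset (Fin n))
    (h0 : (stage G D 0).allV ⊆ W) (hW : ∀ e, 2 ≤ ((G e).1 ∩ W).card → (G e).1 ⊆ W) :
    highPart G D ⊆ W := by
  have hall : ∀ i, (stage G D i).newV ⊆ (stage G D i).allV ∧ (stage G D i).allV ⊆ W := by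
    intro i
    induction i with
    | zero => exact ⟨Finset.Subset.refl _, h0⟩
    | succ i ih =>
      refine ⟨Finset.subset_union_right, Finset.union_subset ih.2 ?_⟩
      refine Finset.sdiff_subset.trans (Finset.biUnion_subset.mpr fun e he => hW e ?_)
      exact (Finset.mem_filter.mp he).2.2.trans
        (Finset.card_le_card (Finset.inter_subset_inter_left ih.2))
  exact Finset.biUnion_subset.mpr fun i _ => (hall i).1.trans (hall i).2

/-- The list of vertices found after `t` rounds of an exploration that starts from `U`. The edge
`e` with `δ e = some (i, j)` is opened in round `j`. -/
noncomputable def explore {T : ℕ} (U : Finset (Fin n)) (G : UniformHypergraph k n m)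
    (δ : Fin m → Option (Fin T × Fin T)) : ℕ → List (Fin n)
  | 0 => U.toList
  | t + 1 => explore U G δ t ++
      (((Finset.univ.filter fun e => ∃ i j, δ e = some (i, j) ∧ j.val = t).biUnion
        fun e => (G e).1) \ (explore U G δ t).toFinset).toList

/-- The constraint on the edge `s` with label `e`: if `δ e = some (i, j)`, then `s` contains the
vertices number `i` and `j` in the list of round `j`. -/
def Linked {T : ℕ} (U : Finset (Fin n)) (δ : Fin m → Option (Fin T × Fin T))
    (G : UniformHypergraph k n m) (e : Fin m) (s : {s : Finset (Fin n) // s.card = k}) : Prop :=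
  ∀ i j, δ e = some (i, j) → ∃ a b, (explore U G δ j)[i.val]? = some a ∧
    (explore U G δ j)[j.val]? = some b ∧ a ≠ b ∧ a ∈ s.1 ∧ b ∈ s.1

section

variable {T : ℕ} {U : Finset (Fin n)} {G G' : UniformHypergraph k n m}
  {δ δ' : Fin m → Option (Fin T × Fin T)}

/-- Only edges opened before round `t` are consulted. This locality lets a code be extended round by
round, and makes the constraints adaptive. -/
theorem explore_congr (t : ℕ)
    (hδ : ∀ e i j, j.val < t → (δ e = some (i, j) ↔ δ' e = some (i, j)))
    (hG : ∀ e i j, j.val < t → δ e = some (i, j) → G e = G' e) :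
    explore U G δ t = explore U G' δ' t := by
  induction t with
  | zero => rfl
  | succ t ih =>
    have ih := ih (fun e i j h => hδ e i j (by omega)) (fun e i j h => hG e i j (by omega))
    have hset : (Finset.univ.filter fun e => ∃ i j, δ e = some (i, j) ∧ j.val = t)
        = Finset.univ.filter fun e => ∃ i j, δ' e = some (i, j) ∧ j.val = t := by
      ext e
      simp only [Finset.mem_filter, Finset.mem_univ, true_and]
      constructor
      · rintro ⟨i, j, h, hj⟩
        exact ⟨i, j, (hδ e i j (by omega)).mp h, hj⟩
      · rintro ⟨i, j, h, hj⟩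
        exact ⟨i, j, (hδ e i j (by omega)).mpr h, hj⟩
    have hbi : (Finset.univ.filter fun e => ∃ i j, δ e = some (i, j) ∧ j.val = t).biUnion
          (fun e => (G e).1)
        = (Finset.univ.filter fun e => ∃ i j, δ' e = some (i, j) ∧ j.val = t).biUnion
          (fun e => (G' e).1) := by
      rw [← hset]
      refine Finset.biUnion_congr rfl fun e he => ?_
      obtain ⟨i, j, h, hj⟩ := (Finset.mem_filter.mp he).2
      rw [hG e i j (by omega) h]
    simp only [explore]
    rw [ih, hbi]

theorem explore_prefix {s t : ℕ} (h : s ≤ t) : explore U G δ s <+: explore U G δ t := by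
  induction t, h using Nat.le_induction with
  | base => exact List.prefix_refl _
  | succ t _ ih => exact ih.trans (List.prefix_append _ _)

theorem explore_nodup (t : ℕ) : (explore U G δ t).Nodup := by
  induction t with
  | zero => exact Finset.nodup_toList U
  | succ t ih =>
    refine List.Nodup.append ih (Finset.nodup_toList _) fun a ha ha' => ?_
    simp only [Finset.mem_toList, Finset.mem_sdiff, List.mem_toFinset] at ha'
    exact ha'.2 ha

/-- The list starts with `U` and has no repetitions, so elements of `U` occur only among the first
`|U|` entries. Thus the index alone bounds the tilt of a vertex. -/
theorem lt_card_of_getElem?_explore {t i : ℕ} {a : Fin n}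
    (h : (explore U G δ t)[i]? = some a) (ha : a ∈ U) : i < U.card := by
  have hp : U.toList <+: explore U G δ t := explore_prefix (Nat.zero_le t)
  obtain ⟨l, hl⟩ := hp
  have hnd := explore_nodup (U := U) (G := G) (δ := δ) t
  rw [← hl] at h hnd
  by_contra hi
  rw [List.getElem?_append_right (by simpa using hi)] at h
  exact (List.nodup_append.mp hnd).2.2 a (by simpa using ha) a (List.mem_of_getElem? h) rfl

theorem subset_explore {t : ℕ} {e : Fin m} {i j : Fin T} (h : δ e = some (i, j)) (hj : j.val < t) :
    ∀ a ∈ (G e).1, a ∈ explore U G δ t := by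
  intro a ha
  apply (explore_prefix (show j.val + 1 ≤ t from hj)).subset
  simp only [explore, List.mem_append, Finset.mem_toList, Finset.mem_sdiff, List.mem_toFinset]
  by_cases h' : a ∈ explore U G δ j
  · exact Or.inl h'
  · refine Or.inr ⟨Finset.mem_biUnion.mpr ⟨e, ?_, ha⟩, h'⟩
    simp [h]

theorem length_explore_le (t : ℕ) :
    (explore U G δ t).length ≤ U.card + k * (Finset.univ.filter fun e => δ e ≠ none).card := by
  have hsub : ∀ t, (explore U G δ t).toFinset
      ⊆ U ∪ (Finset.univ.filter fun e => δ e ≠ none).biUnion fun e => (G e).1 := by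
    intro t
    induction t with
    | zero => simp [explore]
    | succ t ih =>
      simp only [explore, List.toFinset_append, Finset.toList_toFinset]
      refine Finset.union_subset ih (Finset.sdiff_subset.trans ?_)
      refine Finset.Subset.trans (Finset.biUnion_subset_biUnion_of_subset_left _ ?_)
        Finset.subset_union_right
      intro e he
      obtain ⟨i, j, h, -⟩ := (Finset.mem_filter.mp he).2
      simp [h]
  rw [← List.toFinset_card_of_nodup (explore_nodup t)]
  refine (Finset.card_le_card (hsub t)).trans ((Finset.card_union_le _ _).trans ?_)
  gcongr
  rw [mul_comm]
  exact Finset.card_biUnion_le_card_mul _ _ _ fun e _ => (G e).2.le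

/-- The code is built by induction on the round. Besides being consistent with `G`, it must be
complete: an edge through two list entries with indices below `t` has already been opened. -/
theorem exists_trace_aux (U : Finset (Fin n)) (G : UniformHypergraph k n m) (t : ℕ) (ht : t ≤ T) :
    ∃ δ : Fin m → Option (Fin T × Fin T),
      (∀ e i j, δ e = some (i, j) → j.val < t) ∧ (∀ e, Linked U δ G e (G e)) ∧
      ∀ e i j a b, i < j → j < t → (explore U G δ t)[i]? = some a →
        (explore U G δ t)[j]? = some b → a ∈ (G e).1 → b ∈ (G e).1 → δ e ≠ none := by
  classical
  induction t with
  | zero => exact ⟨fun _ => none, by simp, fun e i j h => by simp at h, by simp⟩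
  | succ t ih =>
    obtain ⟨δ, h1, h2, h3⟩ := ih (by omega)
    -- Round `t` examines just the pairs whose later entry has index `t`, so each pair of positions
    -- is treated once. An edge opened earlier keeps its code.
    let Q : Fin m → Fin T → Prop := fun e i => i.val < t ∧ ∃ a b, (explore U G δ t)[i.val]? = some a ∧
      (explore U G δ t)[t]? = some b ∧ a ∈ (G e).1 ∧ b ∈ (G e).1
    let δ' : Fin m → Option (Fin T × Fin T) := fun e =>
      if δ e ≠ none then δ e
      else if h : ∃ i, Q e i then some (h.choose, ⟨t, ht⟩) else none
    have hold : ∀ e, δ e ≠ none → δ' e = δ e := fun e he => if_pos he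
    have hnew : ∀ e i j, δ e = none → δ' e = some (i, j) → Q e i ∧ j.val = t := by
      intro e i j he h
      by_cases hQ : ∃ i, Q e i
      · simp only [δ', he, hQ, ne_eq, not_true_eq_false, if_false, dif_pos, Option.some.injEq,
          Prod.mk.injEq] at h
        exact ⟨h.1 ▸ hQ.choose_spec, by rw [← h.2]⟩
      · simp [δ', he, hQ] at h
    have hiff : ∀ e i j, j.val < t → (δ e = some (i, j) ↔ δ' e = some (i, j)) := by
      intro e i j hj
      by_cases he : δ e = none
      · constructor
        · intro h; simp [he] at h
        · intro h
          have := (hnew e i j he h).2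
          omega
      · rw [hold e he]
    have hexp : ∀ s, s ≤ t → explore U G δ s = explore U G δ' s := fun s hs =>
      explore_congr s (fun e i j h => hiff e i j (by omega)) (fun _ _ _ _ _ => rfl)
    have hlt : ∀ e i j, δ' e = some (i, j) → j.val < t + 1 := by
      intro e i j h
      by_cases he : δ e = none
      · have := (hnew e i j he h).2
        omega
      · rw [hold e he] at h
        have := h1 e i j h
        omega
    refine ⟨δ', hlt, ?_, ?_⟩
    · intro e i j h
      by_cases he : δ e = none
      · obtain ⟨⟨hi, a, b, ha, hb, hae, hbe⟩, hj⟩ := hnew e i j he h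
        rw [hj, ← hexp t le_rfl]
        refine ⟨a, b, ha, hb, ?_, hae, hbe⟩
        rintro rfl
        have hil : i.val < (explore U G δ t).length := (List.getElem?_eq_some_iff.mp ha).1
        have := (List.nodup_iff_getElem?_ne_getElem?.mp (explore_nodup (U := U) (G := G) (δ := δ) t))
          i t hi (List.getElem?_eq_some_iff.mp hb).1
        exact this (ha.trans hb.symm)
      · have h' := h
        rw [hold e he] at h'
        rw [← hexp j (by have := h1 e i j h'; omega)]
        exact h2 e i j h'
    · intro e i j a b hij hj ha hb hae hbe
      by_cases he : δ e = none
      swap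
      · rw [hold e he]; exact he
      -- Round `t` does not alter the entries with index at most `t`: either entry `t` already
      -- exists and the list only grows behind it, or it is missing, and then no edge is opened.
      have hshort : ∀ l, l ≤ t → (explore U G δ' (t + 1))[l]? = (explore U G δ t)[l]? := by
        intro l hl
        by_cases hlen : t < (explore U G δ t).length
        · have hp : explore U G δ' t <+: explore U G δ' (t + 1) := explore_prefix (Nat.le_succ t)
          obtain ⟨r, hr⟩ := hp
          rw [← hr, ← hexp t le_rfl, List.getElem?_append_left (by omega)]
        · have hempty : (Finset.univ.filter fun e => ∃ i j, δ' e = some (i, j) ∧ j.val = t) = ∅ := by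
            rw [Finset.filter_eq_empty_iff]
            rintro e' - ⟨i', j', h', hj'⟩
            by_cases he' : δ e' = none
            · obtain ⟨⟨-, -, b', -, hb', -⟩, -⟩ := hnew e' i' j' he' h'
              exact hlen (List.getElem?_eq_some_iff.mp hb').1
            · rw [hold e' he'] at h'
              have := h1 e' i' j' h'
              omega
          simp only [explore, hempty, Finset.biUnion_empty, Finset.empty_sdiff,
            Finset.toList_empty, List.append_nil, hexp t le_rfl]
      rw [hshort i (by omega)] at ha
      rw [hshort j (by omega)] at hb
      by_cases hjt : j < t
      · exact absurd he (h3 e i j a b hij hjt ha hb hae hbe)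
      · obtain rfl : j = t := by omega
        have hQ : ∃ i, Q e i := ⟨⟨i, by omega⟩, hij, a, b, ha, hb, hae, hbe⟩
        simp [δ', he, hQ]

/-- Either the exploration from `U` gets stuck in a closed set of at most `T` vertices, or it
opens many edges. -/
theorem exists_trace (U : Finset (Fin n)) (G : UniformHypergraph k n m) (T : ℕ) :
    ∃ δ : Fin m → Option (Fin T × Fin T), (∀ e, Linked U δ G e (G e)) ∧
      ((∃ W : Finset (Fin n), W.card ≤ T ∧ U ⊆ W ∧
        ∀ e, 2 ≤ ((G e).1 ∩ W).card → (G e).1 ⊆ W) ∨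
       T < U.card + k * (Finset.univ.filter fun e => δ e ≠ none).card) := by
  obtain ⟨δ, h1, h2, h3⟩ := exists_trace_aux (T := T) U G T le_rfl
  refine ⟨δ, h2, ?_⟩
  by_cases hlen : (explore U G δ T).length ≤ T
  · refine Or.inl ⟨(explore U G δ T).toFinset, (List.toFinset_card_le _).trans hlen, ?_, ?_⟩
    · intro a ha
      rw [List.mem_toFinset]
      exact (explore_prefix (Nat.zero_le T)).subset (by simpa [explore] using ha)
    · intro e he
      obtain ⟨a, ha, b, hb, hab⟩ := Finset.one_lt_card.mp he
      rw [Finset.mem_inter, List.mem_toFinset] at ha hb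
      obtain ⟨i, hi⟩ := List.mem_iff_getElem?.mp ha.2
      obtain ⟨j, hj⟩ := List.mem_iff_getElem?.mp hb.2
      have hi' := (List.getElem?_eq_some_iff.mp hi).1
      have hj' := (List.getElem?_eq_some_iff.mp hj).1
      have hne : δ e ≠ none := by
        rcases lt_trichotomy i j with h | h | h
        · exact h3 e i j a b h (by omega) hi hj ha.1 hb.1
        · rw [h, hj] at hi
          exact absurd (Option.some.inj hi).symm hab
        · exact h3 e j i b a h (by omega) hj hi hb.1 ha.1
      obtain ⟨⟨i', j'⟩, h'⟩ := Option.ne_none_iff_exists'.mp hne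
      intro c hc
      rw [List.mem_toFinset]
      exact subset_explore h' (h1 e i' j' h') c hc
  · exact Or.inr (lt_of_lt_of_le (not_le.mp hlen) (length_explore_le T))

end

end HighDegree

/-! ### Probabilities as normalised counts -/

theorem card_uniformEdge (k n : ℕ) :
    Fintype.card {s : Finset (Fin n) // s.card = k} = n.choose k := by
  rw [Fintype.card_finset_len, Fintype.card_fin]

theorem card_uniformHypergraph (k n m : ℕ) :
    (Nat.card (UniformHypergraph k n m) : ℝ) = (n.choose k : ℝ) ^ m := by
  rw [Nat.card_eq_fintype_card, Fintype.card_fun, card_uniformEdge, Fintype.card_fin]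
  push_cast
  rfl

/-- Markov's inequality in counting form. -/
theorem gnmProb_le_of_weight {k n m : ℕ} (hkn : k ≤ n) (P : UniformHypergraph k n m → Prop)
    (f : UniformHypergraph k n m → ℝ) (B : ℝ) (hf : ∀ G, 0 ≤ f G) (hP : ∀ G, P G → 1 ≤ f G)
    (hB : ∑ G, f G ≤ (n.choose k : ℝ) ^ m * B) : gnmProb k n m P ≤ B := by
  classical
  have hN : (0 : ℝ) < n.choose k := by exact_mod_cast Nat.choose_pos hkn
  rw [gnmProb, card_uniformHypergraph, div_le_iff₀ (by positivity), mul_comm]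
  refine le_trans ?_ hB
  rw [Nat.card_eq_fintype_card, Fintype.card_subtype, Finset.card_filter]
  push_cast
  apply Finset.sum_le_sum
  intro G _
  split_ifs with h
  · exact hP G h
  · exact hf G

theorem gnmProb_mono {k n m : ℕ} {P Q : UniformHypergraph k n m → Prop} (h : ∀ G, P G → Q G) :
    gnmProb k n m P ≤ gnmProb k n m Q := by
  classical
  unfold gnmProb
  gcongr
  simp only [Nat.card_eq_fintype_card]
  exact Fintype.card_subtype_mono P Q h

theorem gnmProb_or_le {k n m : ℕ} (P Q : UniformHypergraph k n m → Prop) :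
    gnmProb k n m (fun G => P G ∨ Q G) ≤ gnmProb k n m P + gnmProb k n m Q := by
  classical
  unfold gnmProb
  rw [← add_div]
  gcongr
  simp only [Nat.card_eq_fintype_card]
  exact_mod_cast Fintype.card_subtype_or P Q

theorem gnmProb_add_not {k n m : ℕ} (hkn : k ≤ n) (P : UniformHypergraph k n m → Prop) :
    gnmProb k n m P + gnmProb k n m (fun G => ¬ P G) = 1 := by
  classical
  have hN : (0 : ℝ) < n.choose k := by exact_mod_cast Nat.choose_pos hkn
  unfold gnmProb
  rw [← add_div, div_eq_one_iff_eq (by rw [card_uniformHypergraph]; positivity)]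
  simp only [Nat.card_eq_fintype_card]
  rw [Fintype.card_subtype_compl]
  have := Fintype.card_subtype_le P
  push_cast [this]
  ring

theorem sum_pow_card_finset {n : ℕ} (y : ℝ) : ∑ U : Finset (Fin n), y ^ U.card = (1 + y) ^ n := by
  have := Fintype.sum_pow_mul_eq_add_pow (Fin n) y 1
  simpa [add_comm] using this

/-! ### Exponential moment bounds for `V_0` and for the closure -/

namespace HighDegree

variable {k n m : ℕ}

/-- Double counting gives `∑ |e ∩ U| = ∑ deg v`, which is at least `D|U|`. Base 3 is the optimal
Chernoff tilt for exceeding a mean of `D/3` by a factor of three. -/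
theorem one_le_weight (G : UniformHypergraph k n m) (D : ℝ) (U : Finset (Fin n))
    (hU : ∀ v ∈ U, D < (degree G v : ℝ)) :
    1 ≤ ((3 : ℝ) ^ (-D)) ^ U.card * ∏ e, (3 : ℝ) ^ ((G e).1 ∩ U).card := by
  have h1 : ∑ e, ((G e).1 ∩ U).card = ∑ v ∈ U, degree G v := by
    simp only [degree, Finset.card_filter]
    rw [Finset.sum_comm]
    apply Finset.sum_congr rfl
    intro e _
    rw [← Finset.card_filter, Finset.filter_mem_eq_inter, Finset.inter_comm]
  rw [Finset.prod_pow_eq_pow_sum, h1, ← Finset.prod_pow_eq_pow_sum, ← Finset.prod_const,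
    ← Finset.prod_mul_distrib]
  have : ∀ v ∈ U, 1 ≤ (3 : ℝ) ^ (-D) * 3 ^ degree G v := by
    intro v hv
    rw [← Real.rpow_natCast, ← Real.rpow_add (by norm_num)]
    exact Real.one_le_rpow (by norm_num) (by linarith [hU v hv])
  calc (1 : ℝ) = ∏ v ∈ U, 1 := by simp
    _ ≤ _ := Finset.prod_le_prod (fun _ _ => zero_le_one) this

/-- Factor for the tilted degree of the vertex with index `i`. -/
noncomputable def tilt (u i : ℕ) : ℝ := if i < u then 3 else 1

theorem tilt_pos (u i : ℕ) : 0 < tilt u i := by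
  unfold tilt; split_ifs <;> norm_num

theorem sum_tilt_le (u T : ℕ) : ∑ i : Fin T, tilt u i ≤ T + 2 * u := by
  have h : ∀ i, tilt u i = 1 + 2 * (if i < u then 1 else 0) := by
    intro i; unfold tilt; split_ifs <;> norm_num
  simp_rw [h, Finset.sum_add_distrib, ← Finset.mul_sum]
  rw [Fin.sum_univ_eq_sum_range (fun i => if i < u then (1 : ℝ) else 0) T, ← Finset.sum_filter]
  have : ((Finset.range T).filter (· < u)).card ≤ u := by
    calc _ ≤ (Finset.range u).card := Finset.card_le_card fun x hx => by
          simp only [Finset.mem_filter, Finset.mem_range] at hx ⊢; exact hx.2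
      _ = u := Finset.card_range u
  have : (((Finset.range T).filter (· < u)).card : ℝ) ≤ u := by exact_mod_cast this
  simp
  linarith

/-- Bound for the tilted number of choices of an edge with the given exploration data. -/
noncomputable def edgeBound (k n u T : ℕ) : Option (Fin T × Fin T) → ℝ
  | none => n.choose k * (1 + 2 * ((k : ℝ) / n)) ^ u
  | some (i, j) => n.choose k * (1 + 2 * ((k : ℝ) / n)) ^ u *
      (((k : ℝ) / n) ^ 2 * (tilt u i * tilt u j))

theorem edgeBound_nonneg (k n u T : ℕ) (o : Option (Fin T × Fin T)) :
    0 ≤ edgeBound k n u T o := by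
  rcases o with _ | ⟨i, j⟩
  · simp only [edgeBound]; positivity
  · have := tilt_pos u i
    have := tilt_pos u j
    simp only [edgeBound]; positivity

-- The list of round `j` is the same for every candidate `s`, so all admissible `s` contain one
-- fixed pair `{a, b}`. This costs `(k/n)²`, and at most a factor 3 for each of `a`, `b` lying in
-- `U`.
open Classical in
theorem sum_linked_edge_le (hn : 0 < n) (hkn : k ≤ n) {T : ℕ} (U : Finset (Fin n))
    (δ : Fin m → Option (Fin T × Fin T)) (G : UniformHypergraph k n m) (e : Fin m) :
    ∑ s with Linked U δ G e s, (3 : ℝ) ^ (s.1 ∩ U).card ≤ edgeBound k n U.card T (δ e) := by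
  have hpos : ∀ o, 0 ≤ edgeBound k n U.card T o := edgeBound_nonneg k n U.card T
  by_cases hemp : ∃ s, Linked U δ G e s
  swap
  · rw [Finset.filter_eq_empty_iff.mpr fun s _ hs => hemp ⟨s, hs⟩, Finset.sum_empty]
    exact hpos _
  obtain ⟨s₀, hs₀⟩ := hemp
  rcases hδ : δ e with _ | ⟨i, j⟩
  · refine le_trans (Finset.sum_le_sum_of_subset_of_nonneg (t := Finset.univ.filter
      fun s : {s : Finset (Fin n) // s.card = k} => ∅ ⊆ s.1) (fun s _ => by simp)
      (fun _ _ _ => by positivity)) ?_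
    refine (sum_three_pow_inter_le hn hkn U ∅).trans (le_of_eq ?_)
    simp [edgeBound]
  · obtain ⟨a, b, ha, hb, hab, -, -⟩ := hs₀ i j hδ
    refine le_trans (Finset.sum_le_sum_of_subset_of_nonneg (t := Finset.univ.filter
      fun s : {s : Finset (Fin n) // s.card = k} => {a, b} ⊆ s.1) (fun s hs => ?_)
      (fun _ _ _ => by positivity)) ?_
    · obtain ⟨a', b', ha', hb', -, has, hbs⟩ := (Finset.mem_filter.mp hs).2 i j hδ
      rw [ha, Option.some.injEq] at ha'
      rw [hb, Option.some.injEq] at hb'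
      subst ha' hb'
      simp [Finset.insert_subset_iff, has, hbs]
    · refine (sum_three_pow_inter_le hn hkn U {a, b}).trans ?_
      have h1 : (3 : ℝ) ^ ({a, b} ∩ U).card ≤ tilt U.card i * tilt U.card j := by
        have key : ∀ (c : Fin n) (l : ℕ), (explore U G δ j)[l]? = some c →
            (3 : ℝ) ^ ({c} ∩ U).card ≤ tilt U.card l := by
          intro c l h
          by_cases hc : c ∈ U
          · have := lt_card_of_getElem?_explore h hc
            rw [Finset.singleton_inter_of_mem hc]
            simp [tilt, this]
          · rw [Finset.singleton_inter_of_notMem hc]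
            simp only [Finset.card_empty, pow_zero, tilt]
            split_ifs <;> norm_num
        have hsum : ({a, b} ∩ U).card ≤ ({a} ∩ U).card + ({b} ∩ U).card := by
          rw [Finset.insert_eq, Finset.union_inter_distrib_right]
          exact Finset.card_union_le _ _
        calc (3 : ℝ) ^ ({a, b} ∩ U).card ≤ 3 ^ (({a} ∩ U).card + ({b} ∩ U).card) := by
              gcongr; norm_num
          _ = 3 ^ ({a} ∩ U).card * 3 ^ ({b} ∩ U).card := pow_add _ _ _
          _ ≤ _ := mul_le_mul (key a i ha) (key b j hb) (by positivity) (tilt_pos _ _).le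
      rw [Finset.card_pair hab]
      simp only [edgeBound]
      calc _ ≤ (n.choose k : ℝ) * (((k : ℝ) / n) ^ 2 * (tilt U.card i * tilt U.card j)
            * (1 + 2 * ((k : ℝ) / n)) ^ U.card) := by gcongr
        _ = _ := by ring

-- Edges are revealed in the order of the rounds in which `δ` opens them. Unopened edges carry no
-- constraint and may have rank 0.
open Classical in
theorem sum_linked_le (hn : 0 < n) (hkn : k ≤ n) {T : ℕ} (U : Finset (Fin n))
    (δ : Fin m → Option (Fin T × Fin T)) :
    ∑ G : UniformHypergraph k n m, ∏ e, (if Linked U δ G e (G e) then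
      (3 : ℝ) ^ ((G e).1 ∩ U).card else 0) ≤ ∏ e, edgeBound k n U.card T (δ e) := by
  have hN : (0 : ℝ) < n.choose k := by exact_mod_cast Nat.choose_pos hkn
  have h := sum_prod_adaptive_le (E := Fin m) (Ω := {s : Finset (Fin n) // s.card = k})
    (fun e => (δ e).elim 0 fun x => x.2.val) (fun s => (3 : ℝ) ^ (s.1 ∩ U).card)
    (fun s => by positivity) (fun G e s => Linked U δ G e s) ?_
    (fun e => edgeBound k n U.card T (δ e)) (fun e => edgeBound_nonneg _ _ _ _ _)
    (fun G e => sum_linked_edge_le hn hkn U δ G e) Finset.univ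
  · rw [card_uniformEdge, Finset.card_univ] at h
    exact le_of_mul_le_mul_left h (by positivity)
  · intro G G' e hGG'
    ext s
    have : ∀ i j, δ e = some (i, j) → explore U G δ j = explore U G' δ j := by
      intro i j h
      refine explore_congr _ (fun _ _ _ _ => Iff.rfl) fun e' i' j' hj' h' => hGG' e' ?_
      simpa [h, h'] using hj'
    constructor
    · intro hL i j h
      rw [← this i j h]
      exact hL i j h
    · intro hL i j h
      rw [this i j h]
      exact hL i j h

/-- This is the sum over all codes of a single edge. Its `m`-th power is the sum over all `δ`,
because the bounds multiply over edges. -/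
theorem sum_edgeBound_le (k n u T : ℕ) (c : ℝ) (hc : 0 ≤ c) :
    ∑ o, (if o = none then 1 else c) * edgeBound k n u T o
      ≤ n.choose k * (1 + 2 * ((k : ℝ) / n)) ^ u *
        (1 + c * ((k : ℝ) / n) ^ 2 * ((T : ℝ) + 2 * u) ^ 2) := by
  rw [Fintype.sum_option, Fintype.sum_prod_type]
  simp only [edgeBound, if_true, reduceCtorEq, if_false, one_mul]
  have h1 : ∑ i : Fin T, ∑ j : Fin T, c * ((n.choose k : ℝ) * (1 + 2 * ((k : ℝ) / n)) ^ u *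
      (((k : ℝ) / n) ^ 2 * (tilt u i * tilt u j)))
      = (n.choose k : ℝ) * (1 + 2 * ((k : ℝ) / n)) ^ u * (c * ((k : ℝ) / n) ^ 2 *
        (∑ i : Fin T, tilt u i) ^ 2) := by
    rw [sq (∑ i : Fin T, tilt u i), Finset.sum_mul_sum]
    simp only [Finset.mul_sum]
    exact Finset.sum_congr rfl fun i _ => Finset.sum_congr rfl fun j _ => by ring
  rw [h1, mul_add, mul_one]
  have h2 : 0 ≤ ∑ i : Fin T, tilt u i := Finset.sum_nonneg fun i _ => (tilt_pos u i).le
  have h3 := sum_tilt_le u T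
  gcongr

theorem gnmProb_card_stage_zero_gt_le (hn : 0 < n) (hkn : k ≤ n) (D X : ℝ) :
    gnmProb k n m (fun G => X < ((stage G D 0).allV.card : ℝ))
      ≤ Real.exp (-X) * (1 + Real.exp 1 * ((3 : ℝ) ^ (-D) * (1 + 2 * ((k : ℝ) / n)) ^ m)) ^ n := by
  classical
  refine gnmProb_le_of_weight hkn _ (fun G => ∑ U : Finset (Fin n), Real.exp (-X) *
    (Real.exp 1 ^ U.card * (((3 : ℝ) ^ (-D)) ^ U.card * ∏ e, (3 : ℝ) ^ ((G e).1 ∩ U).card))) _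
    (fun G => by positivity) ?_ ?_
  · intro G hG
    set U := (stage G D 0).allV with hU
    refine le_trans ?_ (Finset.single_le_sum (fun U _ => by positivity) (Finset.mem_univ U))
    have h1 := one_le_weight G D U (fun v hv => by
      rw [hU] at hv
      exact (Finset.mem_filter.mp hv).2)
    rw [← mul_assoc, ← Real.exp_nat_mul, ← Real.exp_add]
    have h2 : 1 ≤ Real.exp (-X + U.card * 1) := Real.one_le_exp (by linarith)
    exact one_le_mul_of_one_le_of_one_le h2 h1
  · rw [Finset.sum_comm]
    have hU : ∀ U : Finset (Fin n), ∑ G : UniformHypergraph k n m,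
        ∏ e, (3 : ℝ) ^ ((G e).1 ∩ U).card
        ≤ (n.choose k * (1 + 2 * ((k : ℝ) / n)) ^ U.card) ^ m := by
      intro U
      have h1 := Fintype.sum_pow
        (fun s : {s : Finset (Fin n) // s.card = k} => (3 : ℝ) ^ (s.1 ∩ U).card) m
      rw [← h1]
      gcongr
      have := sum_three_pow_inter_le hn hkn U ∅
      simpa using this
    have hsum := sum_pow_card_finset (n := n)
      (Real.exp 1 * ((3 : ℝ) ^ (-D) * (1 + 2 * ((k : ℝ) / n)) ^ m))
    rw [← hsum, Finset.mul_sum, Finset.mul_sum]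
    apply Finset.sum_le_sum
    intro U _
    rw [← Finset.mul_sum, ← Finset.mul_sum, ← Finset.mul_sum]
    calc _ ≤ Real.exp (-X) * (Real.exp 1 ^ U.card * (((3 : ℝ) ^ (-D)) ^ U.card *
          (n.choose k * (1 + 2 * ((k : ℝ) / n)) ^ U.card) ^ m)) := by
          gcongr; exact hU U
      _ = _ := by rw [mul_pow, mul_pow, mul_pow]; ring

theorem gnmProb_card_highPart_gt_le (hn : 0 < n) (hk : 0 < k) (hkn : k ≤ n) (D X : ℝ) (T : ℕ) :
    gnmProb k n m (fun G => ((stage G D 0).allV.card : ℝ) ≤ X ∧ T < (highPart G D).card)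
      ≤ Real.exp (-(2 * (T - X) / k)) *
        (1 + Real.exp 2 * ((k : ℝ) / n) ^ 2 * ((T : ℝ) + 2 * X) ^ 2) ^ m *
        (1 + (3 : ℝ) ^ (-D) * (1 + 2 * ((k : ℝ) / n)) ^ m) ^ n := by
  classical
  refine gnmProb_le_of_weight hkn _ (fun G => ∑ U : Finset (Fin n) with (U.card : ℝ) ≤ X,
    ∑ δ : Fin m → Option (Fin T × Fin T),
    Real.exp (-(2 * (T - X) / k)) * (((3 : ℝ) ^ (-D)) ^ U.card *
      ((∏ e, if δ e = none then 1 else Real.exp 2) *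
        ∏ e, (if Linked U δ G e (G e) then (3 : ℝ) ^ ((G e).1 ∩ U).card else 0)))) _
    (fun G => by positivity) ?_ ?_
  · rintro G ⟨hG, hT⟩
    set U := (stage G D 0).allV with hU
    -- The single term with `U = V_0` and this code already has weight at least 1.
    obtain ⟨δ, hL, hor⟩ := exists_trace U G T
    refine le_trans ?_ (Finset.single_le_sum (fun U _ => by positivity)
      (Finset.mem_filter.mpr ⟨Finset.mem_univ U, hG⟩))
    refine le_trans ?_ (Finset.single_le_sum (fun δ _ => by positivity) (Finset.mem_univ δ))
    have h1 := one_le_weight G D U (fun v hv => by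
      rw [hU] at hv
      exact (Finset.mem_filter.mp hv).2)
    have h2 : ∏ e, (if Linked U δ G e (G e) then (3 : ℝ) ^ ((G e).1 ∩ U).card else 0)
        = ∏ e, (3 : ℝ) ^ ((G e).1 ∩ U).card :=
      Finset.prod_congr rfl fun e _ => if_pos (hL e)
    rcases hor with ⟨W, hWT, hUW, hW⟩ | hbig
    -- A closed set of at most `T` vertices would contain the high-degree part, contradicting its
    -- size.
    · have := Finset.card_le_card (highPart_subset_of_closed G D W hUW hW)
      omega
    · have h3 : (∏ e, if δ e = none then 1 else Real.exp 2)
          = Real.exp ((Finset.univ.filter fun e => δ e ≠ none).card * 2) := by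
        rw [Finset.prod_ite, Finset.prod_const_one, one_mul, Finset.prod_const, Real.exp_nat_mul]
      have h4 : (T : ℝ) < U.card + k * (Finset.univ.filter fun e => δ e ≠ none).card := by
        exact_mod_cast hbig
      have h5 : 1 ≤ Real.exp (-(2 * (T - X) / k)) * (∏ e, if δ e = none then 1 else Real.exp 2) := by
        rw [h3, ← Real.exp_add]
        apply Real.one_le_exp
        have hk0 : (0 : ℝ) < k := by exact_mod_cast hk
        have : 2 * (T - X) / k ≤ (Finset.univ.filter fun e => δ e ≠ none).card * 2 := by
          rw [div_le_iff₀ hk0]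
          linarith
        linarith
      rw [h2]
      calc (1 : ℝ) ≤ _ := one_le_mul_of_one_le_of_one_le h5 h1
        _ = _ := by ring
  · rw [Finset.sum_comm]
    have hsum := sum_pow_card_finset (n := n) ((3 : ℝ) ^ (-D) * (1 + 2 * ((k : ℝ) / n)) ^ m)
    rw [← hsum, Finset.mul_sum, Finset.mul_sum]
    refine le_trans (Finset.sum_le_sum fun U hU => ?_)
      (Finset.sum_le_sum_of_subset_of_nonneg (Finset.filter_subset _ _)
        fun U _ _ => by positivity)
    have hUX : (U.card : ℝ) ≤ X := (Finset.mem_filter.mp hU).2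
    rw [Finset.sum_comm]
    calc _ ≤ ∑ δ : Fin m → Option (Fin T × Fin T), Real.exp (-(2 * (T - X) / k)) *
          (((3 : ℝ) ^ (-D)) ^ U.card * ((∏ e, if δ e = none then 1 else Real.exp 2) *
            ∏ e, edgeBound k n U.card T (δ e))) := by
          apply Finset.sum_le_sum
          intro δ _
          rw [← Finset.mul_sum, ← Finset.mul_sum, ← Finset.mul_sum]
          have := sum_linked_le (m := m) hn hkn U δ
          gcongr
      _ = Real.exp (-(2 * (T - X) / k)) * (((3 : ℝ) ^ (-D)) ^ U.card *
          (∑ o, (if o = none then 1 else Real.exp 2) * edgeBound k n U.card T o) ^ m) := by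
          rw [← Finset.mul_sum, ← Finset.mul_sum, Fintype.sum_pow]
          simp only [Finset.prod_mul_distrib]
      _ ≤ Real.exp (-(2 * (T - X) / k)) * (((3 : ℝ) ^ (-D)) ^ U.card *
          (n.choose k * (1 + 2 * ((k : ℝ) / n)) ^ U.card *
            (1 + Real.exp 2 * ((k : ℝ) / n) ^ 2 * ((T : ℝ) + 2 * X) ^ 2)) ^ m) := by
          have h0 : 0 ≤ ∑ o, (if o = none then 1 else Real.exp 2) * edgeBound k n U.card T o :=
            Finset.sum_nonneg fun o _ => mul_nonneg (by split_ifs <;> positivity)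
              (edgeBound_nonneg _ _ _ _ _)
          have h1 := sum_edgeBound_le k n U.card T (Real.exp 2) (Real.exp_pos 2).le
          gcongr
          refine h1.trans ?_
          gcongr
      _ = _ := by rw [mul_pow, mul_pow, mul_pow]; ring

end HighDegree

/-! ### Numerical estimates -/

theorem mul_sq_le_two_pow {k : ℕ} (hk : 12 ≤ k) : 4096 * k ^ 2 ≤ 144 * 2 ^ k := by
  induction k, hk using Nat.le_induction with
  | base => norm_num
  | succ k hk ih =>
    rw [pow_succ 2]
    nlinarith

theorem cutoffDegree_ge {k : ℕ} (hk : 12 ≤ k) : 2.6 * (k : ℝ) ≤ cutoffDegree k := by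
  have h1 : (4096 : ℝ) * k ^ 2 ≤ 144 * 2 ^ k := by exact_mod_cast mul_sq_le_two_pow hk
  have hk0 : (0 : ℝ) < k := by exact_mod_cast (by omega : 0 < k)
  have he := Real.exp_one_lt_d9
  have he0 := Real.exp_pos 1
  rw [cutoffDegree, le_div_iff₀ (by positivity)]
  have h2 : Real.exp 1 * (k : ℝ) ^ 2 ≤ 2.7182818286 * (k : ℝ) ^ 2 := by gcongr
  nlinarith

/-- The left side decreases for `D` beyond `1/0.1075`, so `D = 31` is the worst case. The rate
`0.1075` is `0.43/4`, for use in a fourth power. -/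
theorem mul_exp_neg_le {D : ℝ} (hD : 31 ≤ D) : D * Real.exp (-(0.1075 * D)) ≤ 1.13 := by
  have h1 : (27.5 : ℝ) ≤ Real.exp (0.1075 * 31) := by
    have h2 : Real.exp (0.1075 * 31) = Real.exp 1 ^ 3 * Real.exp 0.3325 := by
      rw [← Real.exp_nat_mul, ← Real.exp_add]; norm_num
    have h3 : (1.3877 : ℝ) ≤ Real.exp 0.3325 :=
      le_trans (by norm_num) (Real.quadratic_le_exp_of_nonneg (by norm_num : (0 : ℝ) ≤ 0.3325))
    have h4 : (2.7182818 : ℝ) ^ 3 ≤ Real.exp 1 ^ 3 := by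
      have := Real.exp_one_gt_d9
      gcongr
      linarith
    rw [h2]
    calc (27.5 : ℝ) ≤ 2.7182818 ^ 3 * 1.3877 := by norm_num
      _ ≤ _ := by gcongr
  have h5 : 1 + 0.1075 * (D - 31) ≤ Real.exp (0.1075 * (D - 31)) := by
    have := Real.add_one_le_exp (0.1075 * (D - 31))
    linarith
  have h6 : Real.exp (0.1075 * D) = Real.exp (0.1075 * 31) * Real.exp (0.1075 * (D - 31)) := by
    rw [← Real.exp_add]; ring_nf
  rw [Real.exp_neg, ← div_eq_mul_inv, div_le_iff₀ (Real.exp_pos _), h6]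
  have h7 : 27.5 * (1 + 0.1075 * (D - 31))
      ≤ Real.exp (0.1075 * 31) * Real.exp (0.1075 * (D - 31)) := by
    gcongr
  linarith

/-- In terms of `θ` and `x = exp(-0.43 D)` this says `x ≤ θ/(2k)`: the density bound for `V_0` is
negligible beside `θ/k`. Since `k ≤ D/2.6`, the product is controlled by the fourth power of `D
exp(-0.1075 D)`. -/
theorem cutoffDegree_mul_exp_neg_le {k : ℕ} (hk : 12 ≤ k) :
    8 * cutoffDegree k * (k : ℝ) ^ 3 * Real.exp (-(0.43 * cutoffDegree k)) ≤ 1 := by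
  have h1 := cutoffDegree_ge hk
  have hk0 : (12 : ℝ) ≤ k := by exact_mod_cast hk
  set D := cutoffDegree k
  have hD : 31 ≤ D := by linarith
  have h2 := mul_exp_neg_le hD
  have h3 : Real.exp (-(0.43 * D)) = Real.exp (-(0.1075 * D)) ^ 4 := by
    rw [← Real.exp_nat_mul]; push_cast; ring_nf
  have h4 : (k : ℝ) ^ 3 ≤ (D / 2.6) ^ 3 := by
    gcongr
    rw [le_div_iff₀ (by norm_num)]
    linarith
  rw [h3]
  calc 8 * D * (k : ℝ) ^ 3 * Real.exp (-(0.1075 * D)) ^ 4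
      ≤ 8 * D * (D / 2.6) ^ 3 * Real.exp (-(0.1075 * D)) ^ 4 := by gcongr
    _ = 8 / 2.6 ^ 3 * (D * Real.exp (-(0.1075 * D))) ^ 4 := by ring
    _ ≤ 8 / 2.6 ^ 3 * 1.13 ^ 4 := by gcongr
    _ ≤ 1 := by norm_num

/-- The hypothesis forces `e²α ≤ 2^(k-2)`, so the root is at most 2 and `γ ≥ 1/(2e)`. -/
theorem matchingGamma_ge {k : ℕ} (hk : 12 ≤ k) {α : ℝ} (hα : 0 < α)
    (hαk : α * (k : ℝ) ≤ cutoffDegree k / 3) : 1 / 6 ≤ matchingGamma k α := by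
  have hk0 : (12 : ℝ) ≤ k := by exact_mod_cast hk
  have he0 := Real.exp_pos 1
  have he3 := Real.exp_one_lt_three
  have h1 : Real.exp 1 ^ 2 * α ≤ 2 ^ ((k : ℝ) - 2) := by
    have h2 : α * (12 * Real.exp 1 * (k : ℝ) ^ 2) ≤ 2 ^ k := by
      rw [cutoffDegree, div_div, le_div_iff₀ (by positivity)] at hαk
      linarith
    have h3 : (2 : ℝ) ^ ((k : ℝ) - 2) = 2 ^ k / 4 := by
      rw [Real.rpow_sub (by norm_num), Real.rpow_natCast]; norm_num
    rw [h3]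
    have h4 : 4 * Real.exp 1 * (α * Real.exp 1) ≤ 12 * (k : ℝ) ^ 2 * (α * Real.exp 1) := by
      gcongr ?_ * _
      nlinarith
    linarith
  have h5 : (Real.exp 1 ^ 2 * α) ^ (1 / ((k : ℝ) - 2)) ≤ 2 := by
    calc (Real.exp 1 ^ 2 * α) ^ (1 / ((k : ℝ) - 2))
        ≤ ((2 : ℝ) ^ ((k : ℝ) - 2)) ^ (1 / ((k : ℝ) - 2)) := by
          apply Real.rpow_le_rpow (by positivity) h1
          apply div_nonneg zero_le_one
          linarith
      _ = 2 := by
          rw [← Real.rpow_mul (by norm_num), mul_one_div_cancel (by linarith), Real.rpow_one]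
  rw [matchingGamma, one_div]
  apply inv_anti₀
  · positivity
  · calc Real.exp 1 * (Real.exp 1 ^ 2 * α) ^ (1 / ((k : ℝ) - 2)) ≤ 3 * 2 := by gcongr
      _ = 6 := by norm_num

/-- The exponent is at most `-(log 3 - 2/3) D`, and `log 3 - 2/3 > 0.43`. -/
theorem three_rpow_mul_pow_le {k n m : ℕ} (hn : 0 < n) {α D : ℝ}
    (hm : (m : ℝ) ≤ α * n) (hD : 0 ≤ D) (hαk : α * (k : ℝ) ≤ D / 3) :
    (3 : ℝ) ^ (-D) * (1 + 2 * ((k : ℝ) / n)) ^ m ≤ Real.exp (-(0.43 * D)) := by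
  have hn0 : (0 : ℝ) < n := by exact_mod_cast hn
  have h1 : (1 + 2 * ((k : ℝ) / n)) ^ m ≤ Real.exp (m * (2 * ((k : ℝ) / n))) := by
    rw [Real.exp_nat_mul]
    gcongr
    rw [add_comm]
    exact Real.add_one_le_exp _
  have h2 : m * (2 * ((k : ℝ) / n)) ≤ 2 * (D / 3) := by
    calc m * (2 * ((k : ℝ) / n)) ≤ α * n * (2 * ((k : ℝ) / n)) := by gcongr
      _ = 2 * (α * k) := by field_simp
      _ ≤ _ := by linarith
  have h3 := Real.log_three_gt_d9
  rw [Real.rpow_def_of_pos (by norm_num)]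
  calc _ ≤ Real.exp (Real.log 3 * -D) * Real.exp (m * (2 * ((k : ℝ) / n))) := by gcongr
    _ = Real.exp (Real.log 3 * -D + m * (2 * ((k : ℝ) / n))) := (Real.exp_add _ _).symm
    _ ≤ _ := by
      apply Real.exp_le_exp.mpr
      nlinarith

theorem one_add_pow_le_exp {a b : ℝ} (ha : 0 ≤ a) (hab : a ≤ b) (n : ℕ) :
    (1 + a) ^ n ≤ Real.exp (n * b) := by
  rw [Real.exp_nat_mul]
  gcongr
  have := Real.add_one_le_exp b
  linarith

theorem exp_two_lt : Real.exp 2 < 7.39 := by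
  have h : Real.exp 2 = Real.exp 1 ^ 2 := by rw [← Real.exp_nat_mul]; norm_num
  have := Real.exp_one_lt_d9
  rw [h]
  calc Real.exp 1 ^ 2 < 2.7182818286 ^ 2 := by gcongr
    _ < _ := by norm_num

/-! ### Choice of constants and the limit -/

theorem gnmProb_highPart_gt_le {k n : ℕ} (hk : 12 ≤ k) (hkn : k ≤ n) {α : ℝ} (hα : 0 < α)
    (hαk : α * (k : ℝ) ≤ cutoffDegree k / 3) {θ x : ℝ}
    (hθ : θ = 1 / (4 * cutoffDegree k * (k : ℝ) ^ 2)) (hx : x = Real.exp (-(0.43 * cutoffDegree k))) :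
    gnmProb k n ⌊α * (n : ℝ)⌋₊ (fun G =>
        ¬ ((HighDegree.highPart G (cutoffDegree k)).card : ℝ) ≤ θ * n)
      ≤ Real.exp (-((θ / 8 - Real.exp 1 * x) * n)) + Real.exp (1 - (0.75 * θ / k - x) * n) := by
  set D := cutoffDegree k with hDdef
  set m := ⌊α * (n : ℝ)⌋₊ with hmdef
  have hk0 : (12 : ℝ) ≤ k := by exact_mod_cast hk
  have hkpos : (0 : ℝ) < k := by linarith
  have hn : 0 < n := by omega
  have hn0 : (0 : ℝ) < n := by exact_mod_cast hn
  have hD : 31 ≤ D := by have := cutoffDegree_ge hk; linarith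
  have hD0 : 0 < D := by linarith
  have hθ0 : 0 < θ := by rw [hθ]; positivity
  have hm : (m : ℝ) ≤ α * n := Nat.floor_le (by positivity)
  have hy := three_rpow_mul_pow_le (k := k) hn hm hD0.le hαk
  rw [← hx] at hy
  set y := (3 : ℝ) ^ (-D) * (1 + 2 * ((k : ℝ) / n)) ^ m with hydef
  have hy0 : 0 ≤ y := by positivity
  set T := ⌊θ * (n : ℝ)⌋₊ with hTdef
  have hT1 : (T : ℝ) ≤ θ * n := Nat.floor_le (by positivity)
  have hT2 : θ * n - 1 ≤ T := by have := Nat.lt_floor_add_one (θ * (n : ℝ)); linarith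
  set X := θ * n / 8 with hXdef
  have hsplit : gnmProb k n m (fun G => ¬ ((HighDegree.highPart G D).card : ℝ) ≤ θ * n)
      ≤ gnmProb k n m (fun G => X < ((HighDegree.stage G D 0).allV.card : ℝ)) +
        gnmProb k n m (fun G => ((HighDegree.stage G D 0).allV.card : ℝ) ≤ X ∧
          T < (HighDegree.highPart G D).card) := by
    refine le_trans (gnmProb_mono fun G hG => ?_) (gnmProb_or_le _ _)
    rcases lt_or_ge X ((HighDegree.stage G D 0).allV.card : ℝ) with h | h
    · exact Or.inl h
    · refine Or.inr ⟨h, ?_⟩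
      have : (T : ℝ) < (HighDegree.highPart G D).card := lt_of_le_of_lt hT1 (not_le.mp hG)
      exact_mod_cast this
  refine hsplit.trans (add_le_add ?_ ?_)
  · refine (HighDegree.gnmProb_card_stage_zero_gt_le hn hkn D X).trans ?_
    have h1 := one_add_pow_le_exp (a := Real.exp 1 * y) (b := Real.exp 1 * x) (by positivity)
      (by gcongr) n
    calc _ ≤ Real.exp (-X) * Real.exp (n * (Real.exp 1 * x)) := by gcongr
      _ = _ := by rw [← Real.exp_add, hXdef]; ring_nf
  · refine (HighDegree.gnmProb_card_highPart_gt_le hn (by omega) hkn D X T).trans ?_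
    have h1 := one_add_pow_le_exp hy0 hy n
    have h2 := one_add_pow_le_exp
      (a := Real.exp 2 * ((k : ℝ) / n) ^ 2 * ((T : ℝ) + 2 * X) ^ 2) (by positivity) le_rfl m
    -- The value of `θ` is chosen for this step: with `αk ≤ D/3` and `4Dk²θ = 1` the constant
    -- becomes `7.39 · 1.25²/12 < 1`. The gain `2(T - X)/k`, about `1.75 θn/k`, then exceeds this
    -- cost by `0.75 θn/k`.
    have h3 : m * (Real.exp 2 * ((k : ℝ) / n) ^ 2 * ((T : ℝ) + 2 * X) ^ 2) ≤ θ / k * n := by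
      have h4 : (T : ℝ) + 2 * X ≤ 1.25 * θ * n := by rw [hXdef]; linarith
      have h5 := exp_two_lt
      calc _ ≤ α * n * (7.39 * ((k : ℝ) / n) ^ 2 * (1.25 * θ * n) ^ 2) := by gcongr
        _ = 7.39 * 1.25 ^ 2 * (α * k) * (k * θ ^ 2 * n) := by field_simp
        _ ≤ 7.39 * 1.25 ^ 2 * (D / 3) * (k * θ ^ 2 * n) := by gcongr
        _ = 7.39 * 1.25 ^ 2 / 12 * (θ / k * n) * (θ * (4 * D * (k : ℝ) ^ 2)) := by
          field_simp; ring
        _ = 7.39 * 1.25 ^ 2 / 12 * (θ / k * n) := by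
          rw [hθ, one_div, inv_mul_cancel₀ (by positivity), mul_one]
        _ ≤ 1 * (θ / k * n) := by gcongr; norm_num
        _ = _ := one_mul _
    have h6 : -(2 * (T - X) / k) ≤ 1 - 1.75 * θ / k * n := by
      have : 2 * (T - X) / k ≥ (1.75 * θ * n - 2) / k := by
        gcongr
        rw [hXdef]; linarith
      have h7 : (1.75 * θ * n - 2) / k = 1.75 * θ / k * n - 2 / k := by ring
      have h8 : 2 / (k : ℝ) ≤ 1 := by rw [div_le_one hkpos]; linarith
      linarith
    calc _ ≤ Real.exp (-(2 * (T - X) / k)) *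
          Real.exp (m * (Real.exp 2 * ((k : ℝ) / n) ^ 2 * ((T : ℝ) + 2 * X) ^ 2)) *
          Real.exp (n * x) := by gcongr
      _ = Real.exp (-(2 * (T - X) / k) +
          m * (Real.exp 2 * ((k : ℝ) / n) ^ 2 * ((T : ℝ) + 2 * X) ^ 2) + n * x) := by
        rw [Real.exp_add, Real.exp_add]
      _ ≤ _ := by
        apply Real.exp_le_exp.mpr
        have h9 : 1.75 * θ / k * n = 0.75 * θ / k * n + θ / k * n := by ring
        linarith

theorem lemma4p5 (k : ℕ) (hk : 12 ≤ k) (α : ℝ) (hα : 0 < α)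
    (hαk : α * (k : ℝ) ≤ cutoffDegree k / 3) :
    ∃ ε₀ : ℝ, ε₀ < matchingGamma k α ∧
      ∃ δ : ℕ → ℝ, Tendsto δ atTop (𝓝 0) ∧
        Tendsto (fun n : ℕ => gnmProb k n ⌊α * (n : ℝ)⌋₊ fun G =>
            ((HighDegree.highPart G (cutoffDegree k)).card : ℝ) ≤ (ε₀ + δ n) * (n : ℝ))
          atTop (𝓝 1) := by
  have hk0 : (12 : ℝ) ≤ k := by exact_mod_cast hk
  have hD : 31 ≤ cutoffDegree k := by have := cutoffDegree_ge hk; linarith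
  have hγ := matchingGamma_ge hk hα hαk
  have hx := cutoffDegree_mul_exp_neg_le hk
  obtain ⟨θ, hθ⟩ : ∃ θ, θ = 1 / (4 * cutoffDegree k * (k : ℝ) ^ 2) := ⟨_, rfl⟩
  obtain ⟨x, hxdef⟩ : ∃ x, x = Real.exp (-(0.43 * cutoffDegree k)) := ⟨_, rfl⟩
  have hprob := fun n (hkn : k ≤ n) => gnmProb_highPart_gt_le (n := n) hk hkn hα hαk hθ hxdef
  rw [← hxdef] at hx
  have hx0 : 0 < x := hxdef ▸ Real.exp_pos _
  generalize cutoffDegree k = D at *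
  have hD0 : 0 < D := by linarith
  have hθ6 : θ < 1 / 6 := by
    rw [hθ]
    apply one_div_lt_one_div_of_lt (by norm_num)
    nlinarith
  have hxθ : x ≤ θ / (2 * k) := by
    rw [hθ, div_div, le_div_iff₀ (by positivity)]
    linarith
  -- Since `2k ≥ 24`, the bound `x ≤ θ/(2k)` gives `ex ≤ eθ/24 < θ/8`.
  have hc1 : 0 < θ / 8 - Real.exp 1 * x := by
    have he := Real.exp_one_lt_d9
    have h1 : x * (2 * k) ≤ θ := by rwa [le_div_iff₀ (by positivity)] at hxθ
    nlinarith
  have hc2 : 0 < 0.75 * θ / k - x := by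
    have hθ0 : 0 < θ / k := by rw [hθ]; positivity
    have h1 : θ / (2 * k) = 0.5 * (θ / k) := by ring
    have h2 : 0.75 * θ / k = 0.75 * (θ / k) := by ring
    linarith
  refine ⟨θ, lt_of_lt_of_le hθ6 hγ, fun _ => 0, tendsto_const_nhds, ?_⟩
  simp only [add_zero]
  have hlin : ∀ c : ℝ, 0 < c → Tendsto (fun n : ℕ => c * (n : ℝ)) atTop atTop := fun c hc =>
    tendsto_natCast_atTop_atTop.const_mul_atTop hc
  have hlim : Tendsto (fun n : ℕ => 1 - (Real.exp (-((θ / 8 - Real.exp 1 * x) * n)) +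
      Real.exp (1 - (0.75 * θ / k - x) * n))) atTop (𝓝 1) := by
    have h1 : Tendsto (fun n : ℕ => Real.exp (-((θ / 8 - Real.exp 1 * x) * n))) atTop (𝓝 0) :=
      Real.tendsto_exp_neg_atTop_nhds_zero.comp (hlin _ hc1)
    have h2 : Tendsto (fun n : ℕ => Real.exp (1 - (0.75 * θ / k - x) * n)) atTop (𝓝 0) :=
      Real.tendsto_exp_atBot.comp
        (tendsto_atBot_add_const_left _ 1 (tendsto_neg_atTop_atBot.comp (hlin _ hc2)))
    simpa using (h1.add h2).const_sub 1
  refine tendsto_of_tendsto_of_tendsto_of_le_of_le' hlim tendsto_const_nhds ?_ ?_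
  · filter_upwards [eventually_ge_atTop k] with n hn
    have h1 := hprob n hn
    have h2 := gnmProb_add_not hn (m := ⌊α * (n : ℝ)⌋₊)
      (fun G => ((HighDegree.highPart G D).card : ℝ) ≤ θ * n)
    linarith
  · filter_upwards [eventually_ge_atTop k] with n hn
    have h2 := gnmProb_add_not hn (m := ⌊α * (n : ℝ)⌋₊)
      (fun G => ((HighDegree.highPart G D).card : ℝ) ≤ θ * n)
    have h3 : 0 ≤ gnmProb k n ⌊α * (n : ℝ)⌋₊
        (fun G => ¬ ((HighDegree.highPart G D).card : ℝ) ≤ θ * n) := by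
      unfold gnmProb; positivity
    linarith
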